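/- Let $n\in\mathbb N$, $\lambda,\gamma,t_0>0$, and let $g:\mathbb R^n\to\mathbb R$ be a Fréchet differentiable function whose gradient is $L_g$-Lipschitz continuous for some $L_g\ge 0$. Assume that $g$ is strongly convex, i.e. there is $m>0$ such that $$g(\alpha u+(1-\alpha)v)\le \alpha g(u)+(1-\alpha)g(v)-\frac m2\,\alpha(1-\alpha)\|u-v\|^2\qquad(u,v\in\mathbb R^n,\ \alpha\in[0,1]),$$ and let $x^*$ be the unique minimizer of $g$. For $u_0,v_0\in\mathbb R^n$, let $x:[t_0,+\infty)\to\mathbb R^n$ be any strong global solution of $$\frac{\lambda}{t^2}\ddot x(t)+\frac{\gamma}{t}\dot x(t)+\nabla g(x(t))=0,\qquad x(t_0)=u_0,\ \dot x(t_0)=v_0, \tag{DS}$$ that is, $x,\dot x,\ddot x:[t_0,+\infty)\to\mathbb R^n$ are absolutely continuous on $[t_0,b]$ for every $b>t_0$, the differential equation holds for almost every $t\ge t_0$, and the initial conditions hold. Then there exist $a_1,a_2>0$ and $t'\ge t_0$ such that for every $t\in[t',+\infty)$ $$\|x(t)-x^*\|\le a_1e^{-a_2t^2}.$$ -/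

import Mathlib

open scoped Gradient

/-- A function `f` on `[t₀, +∞)` (values of `f` below `t₀` play no role) is locally absolutely
continuous if it is absolutely continuous on every interval `[t₀, b]`. -/
def LocallyAbsContFrom {E : Type*} [PseudoMetricSpace E] (f : ℝ → E) (t₀ : ℝ) : Prop :=
  ∀ b : ℝ, t₀ < b → AbsolutelyContinuousOnInterval f t₀ b

/-- The velocity of a trajectory on `[t₀, +∞)`; at `t₀` it is the one-sided derivative. -/
noncomputable def velocityFrom {n : ℕ} (t₀ : ℝ) (x : ℝ → EuclideanSpace ℝ (Fin n)) :
    ℝ → EuclideanSpace ℝ (Fin n) :=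
  derivWithin x (Set.Ici t₀)

/-- The acceleration of a trajectory on `[t₀, +∞)`. -/
noncomputable def accelerationFrom {n : ℕ} (t₀ : ℝ) (x : ℝ → EuclideanSpace ℝ (Fin n)) :
    ℝ → EuclideanSpace ℝ (Fin n) :=
  velocityFrom t₀ (velocityFrom t₀ x)

/-- `x : [t₀, +∞) → ℝⁿ` is a strong global solution of the dynamical system
`(lam / t²) x'' + (gam / t) x' + ∇ g (x) = 0`, `x t₀ = u₀`, `x' t₀ = v₀`. -/
structure IsStrongGlobalSolution {n : ℕ} (g : EuclideanSpace ℝ (Fin n) → ℝ)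
    (lam gam t₀ : ℝ) (u₀ v₀ : EuclideanSpace ℝ (Fin n))
    (x : ℝ → EuclideanSpace ℝ (Fin n)) : Prop where
  differentiableOn : DifferentiableOn ℝ x (Set.Ici t₀)
  differentiableOn_velocity : DifferentiableOn ℝ (velocityFrom t₀ x) (Set.Ici t₀)
  locallyAbsCont : LocallyAbsContFrom x t₀
  locallyAbsCont_velocity : LocallyAbsContFrom (velocityFrom t₀ x) t₀
  locallyAbsCont_acceleration : LocallyAbsContFrom (accelerationFrom t₀ x) t₀
  ode : ∀ᵐ t : ℝ, t₀ ≤ t →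
    (lam / t ^ 2) • accelerationFrom t₀ x t + (gam / t) • velocityFrom t₀ x t + ∇ g (x t) = 0
  initial_position : x t₀ = u₀
  initial_velocity : velocityFrom t₀ x t₀ = v₀

/-! In the time variable s = t²/2 the velocity is v = dx/ds = x'/t, and the system becomes a heavy
ball equation with damping c + 1/t², where c = γ/λ, and force -κ∇g, where κ = 1/λ. For strongly
convex g such a system decays exponentially in s, hence like exp(-a t²).
`exists_norm_sub_le_exp_of_heavyBall` proves this with a Lyapunov function W that dominates ‖x - p‖²
and satisfies W' ≤ -δ t W. -/

open Set Filter MeasureTheory Topology in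
/-- First-order characterization of strong convexity. -/
lemma StrongConvexOn.add_inner_gradient_le {E : Type*} [NormedAddCommGroup E]
    [InnerProductSpace ℝ E] [CompleteSpace E] {g : E → ℝ} {m : ℝ}
    (hconv : StrongConvexOn univ m g) {x : E} (hg : DifferentiableAt ℝ g x) (y : E) :
    g x + inner ℝ (∇ g x) (y - x) + m / 2 * ‖y - x‖ ^ 2 ≤ g y := by
  have hd : HasDerivAt (fun s : ℝ => g (x + s • (y - x))) (inner ℝ (∇ g x) (y - x)) 0 := by
    have hline : HasDerivAt (fun s : ℝ => x + s • (y - x)) (y - x) 0 := by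
      simpa using ((hasDerivAt_id (0 : ℝ)).smul_const (y - x)).const_add x
    have hF : HasFDerivAt g (fderiv ℝ g x) (x + (0 : ℝ) • (y - x)) := by
      simpa using hg.hasFDerivAt
    exact (hF.comp_hasDerivAt 0 hline).congr_deriv inner_gradient_left.symm
  have hslope := (hasDerivAt_iff_tendsto_slope.1 hd).mono_left
    (nhdsWithin_mono 0 (fun s (hs : 0 < s) => hs.ne') : 𝓝[>] (0 : ℝ) ≤ 𝓝[≠] 0)
  -- Strong convexity at weight s, divided by s, bounds the slope by this function; the factor 1 - s
  -- is s(1 - s)/s.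
  have hlim : Tendsto (fun s : ℝ => g y - g x - (1 - s) * (m / 2 * ‖y - x‖ ^ 2)) (𝓝[>] 0)
      (𝓝 (g y - g x - (1 - 0) * (m / 2 * ‖y - x‖ ^ 2))) :=
    ((by fun_prop : Continuous fun s : ℝ =>
      g y - g x - (1 - s) * (m / 2 * ‖y - x‖ ^ 2)).tendsto 0).mono_left nhdsWithin_le_nhds
  have hle := le_of_tendsto_of_tendsto hslope hlim (by
    filter_upwards [Ioo_mem_nhdsGT (zero_lt_one' ℝ)] with s hs
    have h := hconv.2 (mem_univ x) (mem_univ y) (by linarith [hs.2] : 0 ≤ 1 - s) hs.1.le (by ring)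
    have hpt : (1 - s) • x + s • y = x + s • (y - x) := by module
    rw [hpt, norm_sub_rev] at h
    simp only [smul_eq_mul] at h
    rw [slope_def_field, zero_smul, add_zero, sub_zero, div_le_iff₀ hs.1]
    linarith)
  linarith

/-- The gradient of a function vanishes at a global minimizer. -/
lemma gradient_eq_zero_of_forall_le {E : Type*} [NormedAddCommGroup E]
    [InnerProductSpace ℝ E] [CompleteSpace E] {g : E → ℝ} {p : E} (hmin : ∀ y, g p ≤ g y) :
    ∇ g p = 0 := by
  have h : IsLocalMin g p := Filter.Eventually.of_forall hmin
  simp [gradient, h.fderiv_eq_zero]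

lemma LocallyAbsContFrom.continuousOn_Ici {E : Type*} [SeminormedAddCommGroup E] {f : ℝ → E} {t₀ : ℝ}
    (hf : LocallyAbsContFrom f t₀) : ContinuousOn f (Set.Ici t₀) := by
  intro t ht
  have ht' : t₀ < t + 1 := lt_of_le_of_lt (Set.mem_Ici.1 ht) (lt_add_one t)
  have h := (hf _ ht').continuousOn
  rw [Set.uIcc_of_le ht'.le] at h
  have hmem : Set.Icc t₀ (t + 1) ∈ nhdsWithin t (Set.Ici t₀) := by
    rw [← Set.Ici_inter_Iic]
    exact Filter.inter_mem self_mem_nhdsWithin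
      (mem_nhdsWithin_of_mem_nhds (Iic_mem_nhds (lt_add_one t)))
  exact (h t ⟨Set.mem_Ici.1 ht, (lt_add_one t).le⟩).mono_of_mem_nhdsWithin hmem

/-- The differential equation of a strong global solution holds at every time, because the
acceleration is continuous. -/
lemma IsStrongGlobalSolution.ode_of_lt {n : ℕ} {g : EuclideanSpace ℝ (Fin n) → ℝ}
    {lam gam t₀ : ℝ} {u₀ v₀ : EuclideanSpace ℝ (Fin n)} {x : ℝ → EuclideanSpace ℝ (Fin n)}
    (hx : IsStrongGlobalSolution g lam gam t₀ u₀ v₀ x) (hg : Continuous (∇ g)) (ht₀ : 0 < t₀)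
    {t : ℝ} (ht : t₀ < t) :
    (lam / t ^ 2) • accelerationFrom t₀ x t + (gam / t) • velocityFrom t₀ x t + ∇ g (x t) = 0 := by
  have hsub : Set.Ioi t₀ ⊆ Set.Ici t₀ := Set.Ioi_subset_Ici_self
  have hae : (fun t => (lam / t ^ 2) • accelerationFrom t₀ x t + (gam / t) • velocityFrom t₀ x t
      + ∇ g (x t)) =ᵐ[MeasureTheory.volume.restrict (Set.Ioi t₀)] fun _ => 0 := by
    refine (MeasureTheory.ae_restrict_iff' measurableSet_Ioi).2 ?_
    filter_upwards [hx.ode] with s hs hs' using hs (le_of_lt hs')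
  have ha := hx.locallyAbsCont_acceleration.continuousOn_Ici.mono hsub
  have hv := hx.locallyAbsCont_velocity.continuousOn_Ici.mono hsub
  have hx' := hx.locallyAbsCont.continuousOn_Ici.mono hsub
  have h2 : ContinuousOn (fun t : ℝ => lam / t ^ 2) (Set.Ioi t₀) :=
    continuousOn_const.div (by fun_prop) fun s hs => pow_ne_zero 2 (ht₀.trans hs).ne'
  have h1 : ContinuousOn (fun t : ℝ => gam / t) (Set.Ioi t₀) :=
    continuousOn_const.div (by fun_prop) fun s hs => (ht₀.trans hs).ne'
  exact MeasureTheory.Measure.eqOn_open_of_ae_eq hae isOpen_Ioi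
    (((h2.smul ha).add (h1.smul hv)).add (hg.comp_continuousOn hx')) continuousOn_const ht

/-- A function with `f' ≤ -δ t f` decays at least like `exp (-δ t² / 2)`. -/
lemma le_mul_exp_of_deriv_le_neg_mul_id {f f' : ℝ → ℝ} {δ t₀ : ℝ}
    (hc : ContinuousOn f (Set.Ici t₀)) (hd : ∀ t, t₀ < t → HasDerivAt f (f' t) t)
    (hle : ∀ t, t₀ < t → f' t ≤ -(δ * t) * f t) {t : ℝ} (ht : t₀ ≤ t) :
    f t ≤ f t₀ * Real.exp (δ / 2 * t₀ ^ 2) * Real.exp (-(δ / 2 * t ^ 2)) := by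
  have hexp : ∀ t : ℝ, HasDerivAt (fun t : ℝ => Real.exp (δ / 2 * t ^ 2))
      (Real.exp (δ / 2 * t ^ 2) * (δ * t)) t := fun t => by
    refine ((hasDerivAt_pow 2 t).const_mul (δ / 2)).exp.congr_deriv ?_
    push_cast
    ring
  have hprod : ∀ t, t₀ < t → HasDerivAt (fun t => f t * Real.exp (δ / 2 * t ^ 2))
      (f' t * Real.exp (δ / 2 * t ^ 2) + f t * (Real.exp (δ / 2 * t ^ 2) * (δ * t))) t :=
    fun t ht => (hd t ht).mul (hexp t)
  -- Integrating factor: the derivative of the product is exp(δt²/2)(f' + δ t f) ≤ 0.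
  have hanti : AntitoneOn (fun t => f t * Real.exp (δ / 2 * t ^ 2)) (Set.Ici t₀) := by
    refine antitoneOn_of_deriv_nonpos (convex_Ici t₀) (hc.mul (by fun_prop)) ?_ ?_
    · intro s hs
      rw [interior_Ici] at hs
      exact (hprod s hs).differentiableAt.differentiableWithinAt
    · intro s hs
      rw [interior_Ici] at hs
      rw [(hprod s hs).deriv]
      nlinarith [hle s hs, Real.exp_pos (δ / 2 * s ^ 2)]
  have h := hanti (Set.self_mem_Ici) ht ht
  simp only at h
  rw [Real.exp_neg, ← div_eq_mul_inv, le_div_iff₀ (Real.exp_pos _)]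
  exact h

/-- Exponential decay for the heavy ball system in the time variable `t² / 2`: here `x' = t v`
and `v' = -t ((c + 1 / t²) v + κ ∇ g (x))`. -/
lemma exists_norm_sub_le_exp_of_heavyBall {E : Type*} [NormedAddCommGroup E]
    [InnerProductSpace ℝ E] [CompleteSpace E] {g : E → ℝ} (hg : Differentiable ℝ g)
    {m : ℝ} (hm : 0 < m) (hconv : StrongConvexOn Set.univ m g)
    {p : E} (hmin : ∀ y, g p ≤ g y) {c κ t₀ : ℝ} (hc : 0 < c) (hκ : 0 < κ) (ht₀ : 0 < t₀)
    {x v : ℝ → E} (hxc : ContinuousOn x (Set.Ici t₀)) (hvc : ContinuousOn v (Set.Ici t₀))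
    (hx : ∀ t, t₀ < t → HasDerivAt x (t • v t) t)
    (hv : ∀ t, t₀ < t → HasDerivAt v (-(t • ((c + 1 / t ^ 2) • v t + κ • ∇ g (x t)))) t) :
    ∃ a₁ a₂ : ℝ, 0 < a₁ ∧ 0 < a₂ ∧
      ∀ t : ℝ, t₀ ≤ t → ‖x t - p‖ ≤ a₁ * Real.exp (-a₂ * t ^ 2) := by
  obtain ⟨ε, hε, hεc, hε1, hεm⟩ : ∃ ε : ℝ, 0 < ε ∧ ε ≤ c / 2 ∧ ε ≤ 1 ∧ ε ≤ m * κ * t₀ ^ 2 :=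
    ⟨min (c / 2) (min 1 (m * κ * t₀ ^ 2)), by positivity, min_le_left _ _,
      (min_le_right _ _).trans (min_le_left _ _), (min_le_right _ _).trans (min_le_right _ _)⟩
  obtain ⟨δ, hδ, hδε, hδm⟩ : ∃ δ : ℝ, 0 < δ ∧ δ ≤ ε ∧ δ * (1 + c) ≤ m * κ / 2 :=
    ⟨min ε (m * κ / 2 / (1 + c)), by positivity, min_le_left _ _, by
      rw [← le_div_iff₀ (by positivity)]; exact min_le_right _ _⟩
  -- Energy plus a small cross term; in the derivative, the last term cancels the contribution -εc⟨x
  -- - p, v⟩ of the damping.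
  let W : ℝ → ℝ := fun t => κ * (g (x t) - g p) + inner ℝ (v t) (v t) / 2
    + ε * inner ℝ (x t - p) (v t) + ε * c / 2 * inner ℝ (x t - p) (x t - p)
  have hgrowth : ∀ y, m / 2 * inner ℝ (y - p) (y - p) ≤ g y - g p := fun y => by
    have h := hconv.add_inner_gradient_le (hg p) y
    rw [gradient_eq_zero_of_forall_le hmin, inner_zero_left] at h
    rw [real_inner_self_eq_norm_sq]
    linarith
  have hmono : ∀ y, g y - g p + m / 2 * inner ℝ (y - p) (y - p) ≤ inner ℝ (∇ g y) (y - p) :=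
    fun y => by
    have h := hconv.add_inner_gradient_le (hg y) p
    rw [← neg_sub y p, inner_neg_right, norm_neg] at h
    rw [real_inner_self_eq_norm_sq]
    linarith
  have hcross : ∀ y w : E, ∀ a : ℝ, 0 ≤ inner ℝ w w + 2 * a * inner ℝ y w + a ^ 2 * inner ℝ y y :=
    fun y w a => by
    have h := real_inner_self_nonneg (x := w + a • y)
    simp only [inner_add_left, inner_add_right, inner_smul_left, inner_smul_right,
      real_inner_comm y w, conj_trivial] at h
    linarith
  have hWlower : ∀ t, m * κ / 2 * ‖x t - p‖ ^ 2 ≤ W t := fun t => by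
    have h1 := hcross (x t - p) (v t) ε
    have h2 := mul_le_mul_of_nonneg_left (hgrowth (x t)) hκ.le
    have h3 : 0 ≤ inner ℝ (x t - p) (x t - p) := real_inner_self_nonneg
    have h4 := mul_nonneg (mul_nonneg hε.le (by linarith : 0 ≤ c - ε)) h3
    rw [← real_inner_self_eq_norm_sq]
    simp only [W]
    linarith
  have hWc : ContinuousOn W (Set.Ici t₀) := by
    have hgc := hg.continuous.comp_continuousOn hxc
    have hyc := hxc.sub (continuousOn_const (c := p))
    exact (((continuousOn_const.mul (hgc.sub continuousOn_const)).add
      ((hvc.inner hvc).div_const 2)).add (continuousOn_const.mul (hyc.inner hvc))).add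
      (continuousOn_const.mul (hyc.inner hyc))
  let W' : ℝ → ℝ := fun t => t * (-(c + 1 / t ^ 2 - ε) * inner ℝ (v t) (v t)
    - ε * κ * inner ℝ (∇ g (x t)) (x t - p) - ε / t ^ 2 * inner ℝ (x t - p) (v t))
  have hWd : ∀ t, t₀ < t → HasDerivAt W (W' t) t := fun t ht => by
    have hy := (hx t ht).sub_const p
    have hgd : HasDerivAt (fun t => g (x t)) (fderiv ℝ g (x t) (t • v t)) t :=
      (hg (x t)).hasFDerivAt.comp_hasDerivAt t (hx t ht)
    have hv' := hv t ht
    have h := (((hgd.sub_const (g p)).const_mul κ).add ((hv'.inner ℝ hv').div_const 2)).add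
      ((hy.inner ℝ hv').const_mul ε) |>.add ((hy.inner ℝ hy).const_mul (ε * c / 2))
    refine h.congr_deriv ?_
    rw [← inner_gradient_left]
    simp only [W', inner_add_left, inner_add_right, inner_smul_left, inner_smul_right,
      inner_neg_left, inner_neg_right, conj_trivial, real_inner_comm (x t - p) (v t),
      real_inner_comm (∇ g (x t)) (v t), real_inner_comm (∇ g (x t)) (x t - p)]
    ring
  have hWle : ∀ t, t₀ < t → W' t ≤ -(δ * t) * W t := fun t ht => by
    have htpos : 0 < t := ht₀.trans ht
    have hG := hgrowth (x t)
    have hQ := mul_le_mul_of_nonneg_left (hmono (x t)) (mul_pos hε hκ).le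
    have hY : 0 ≤ inner ℝ (x t - p) (x t - p) := real_inner_self_nonneg
    have hV : 0 ≤ inner ℝ (v t) (v t) := real_inner_self_nonneg
    -- `hP1` bounds the cross term of δW. `hP2`, multiplied by 1/t², bounds the cross term left by
    -- the extra damping: its ‖v‖² part is absorbed by that damping, its ‖x - p‖² part by strong
    -- convexity, since ε/t² ≤ mκ.
    have hP1 := hcross (x t - p) (v t) (-1)
    have hP2 := hcross (x t - p) (v t) (ε / 2)
    have hr : 0 < 1 / t ^ 2 := by positivity
    have hεr : ε * (1 / t ^ 2) ≤ m * κ := by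
      rw [mul_one_div, div_le_iff₀ (by positivity)]
      refine hεm.trans ?_
      gcongr
    have hdiv : ε / t ^ 2 = ε * (1 / t ^ 2) := by ring
    suffices h : -(c + 1 / t ^ 2 - ε) * inner ℝ (v t) (v t)
        - ε * κ * inner ℝ (∇ g (x t)) (x t - p) - ε / t ^ 2 * inner ℝ (x t - p) (v t)
        ≤ -δ * W t by
      have := mul_le_mul_of_nonneg_left h htpos.le
      simp only [W']
      linarith
    rw [hdiv]
    simp only [W]
    generalize 1 / t ^ 2 = r at *
    generalize g (x t) - g p = G at *
    generalize inner ℝ (x t - p) (x t - p) = Y at *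
    generalize inner ℝ (v t) (v t) = V at *
    generalize inner ℝ (x t - p) (v t) = P at *
    generalize inner ℝ (∇ g (x t)) (x t - p) = Q at *
    have hGnn : 0 ≤ G := le_trans (by positivity) hG
    have e1 := mul_nonneg hr.le hP2
    have e2 := mul_nonneg (mul_nonneg hε.le (sub_nonneg.2 hεr)) hY
    have e3 := mul_nonneg (mul_nonneg hκ.le (sub_nonneg.2 hδε)) hGnn
    have e4 := mul_nonneg (mul_nonneg hε.le (sub_nonneg.2 hδm)) hY
    have e5 := mul_nonneg (mul_nonneg hδ.le hε.le) hP1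
    have e6 := mul_nonneg (mul_nonneg hδ.le (sub_nonneg.2 hε1)) hV
    have e7 := mul_nonneg (sub_nonneg.2 hδε) hV
    have e8 := mul_nonneg (sub_nonneg.2 hεc) hV
    linarith
  have hdecay := fun t ht => le_mul_exp_of_deriv_le_neg_mul_id (t := t) hWc hWd hWle ht
  set C : ℝ := W t₀ * Real.exp (δ / 2 * t₀ ^ 2) with hC
  have hW0 : 0 ≤ W t₀ := le_trans (by positivity) (hWlower t₀)
  have hC0 : 0 ≤ C := by positivity
  -- The square root halves the rate δ/2; the + 1 keeps a₁ positive when C = 0.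
  refine ⟨√(C / (m * κ / 2)) + 1, δ / 4, by positivity, by positivity, fun t ht => ?_⟩
  have hsq : ‖x t - p‖ ^ 2 ≤ (√(C / (m * κ / 2)) * Real.exp (-(δ / 4) * t ^ 2)) ^ 2 := by
    rw [mul_pow, Real.sq_sqrt (by positivity), ← Real.exp_nat_mul, div_mul_eq_mul_div,
      le_div_iff₀ (by positivity)]
    have h := (hWlower t).trans (hdecay t ht)
    convert h using 1
    · ring
    · congr 2
      push_cast
      ring
  refine (le_of_sq_le_sq hsq (by positivity)).trans ?_
  gcongr
  linarith

theorem theorem5p3 {n : ℕ} (g : EuclideanSpace ℝ (Fin n) → ℝ)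
    (hg : Differentiable ℝ g) (Lg : NNReal) (hLg : LipschitzWith Lg (∇ g))
    (m : ℝ) (hm : 0 < m) (hconv : StrongConvexOn Set.univ m g)
    (xstar : EuclideanSpace ℝ (Fin n)) (hmin : ∀ y, g xstar ≤ g y)
    (lam gam t₀ : ℝ) (hlam : 0 < lam) (hgam : 0 < gam) (ht₀ : 0 < t₀)
    (u₀ v₀ : EuclideanSpace ℝ (Fin n)) (x : ℝ → EuclideanSpace ℝ (Fin n))
    (hx : IsStrongGlobalSolution g lam gam t₀ u₀ v₀ x) :
    ∃ a₁ a₂ t' : ℝ, 0 < a₁ ∧ 0 < a₂ ∧ 0 < t' ∧ t₀ ≤ t' ∧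
      ∀ t : ℝ, t' ≤ t → ‖x t - xstar‖ ≤ a₁ * Real.exp (-a₂ * t ^ 2) := by
  have hne : ∀ t ∈ Set.Ici t₀, t ≠ 0 := fun t ht => (lt_of_lt_of_le ht₀ ht).ne'
  obtain ⟨a₁, a₂, h₁, h₂, h⟩ := exists_norm_sub_le_exp_of_heavyBall hg hm hconv hmin
    (c := gam / lam) (κ := 1 / lam) (t₀ := t₀) (x := x) (v := fun t => t⁻¹ • velocityFrom t₀ x t)
    (by positivity) (by positivity) ht₀ hx.locallyAbsCont.continuousOn_Ici
    ((continuousOn_inv₀.mono hne).smul hx.locallyAbsCont_velocity.continuousOn_Ici)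
    (fun t ht => by
      rw [smul_inv_smul₀ (hne t ht.le)]
      exact (hx.differentiableOn t ht.le).hasDerivWithinAt.hasDerivAt (Ici_mem_nhds ht))
    (fun t ht => by
      have ht' := hne t ht.le
      have ha : HasDerivAt (velocityFrom t₀ x) (accelerationFrom t₀ x t) t :=
        (hx.differentiableOn_velocity t ht.le).hasDerivWithinAt.hasDerivAt (Ici_mem_nhds ht)
      have hode := hx.ode_of_lt hLg.continuous ht₀ ht
      have hgrad : ∇ g (x t) = -((lam / t ^ 2) • accelerationFrom t₀ x t
          + (gam / t) • velocityFrom t₀ x t) := (neg_eq_of_add_eq_zero_right hode).symm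
      -- Differentiating the factor t⁻¹ in v produces the extra damping 1/t².
      refine ((hasDerivAt_inv ht').smul ha).congr_deriv ?_
      rw [hgrad]
      match_scalars <;> field_simp
      ring)
  exact ⟨a₁, a₂, t₀, h₁, h₂, ht₀, le_rfl, h⟩
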